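/- For a field $F$ and a partition $\lambda=(\lambda_1\ge\dots\ge\lambda_t)$ of $N$, let $\mathcal O_\lambda\subset M_N(F)$ be the set of nilpotent matrices whose Jordan canonical form has blocks of sizes $\lambda_1,\dots,\lambda_t$. For $B\in M_N(F)$ let $\mathcal N(B)$ be the set of all nilpotent matrices in $M_N(F)$ that commute with $B$. Write $m^t$ for $t$ copies of the part $m$. For integers $N,k$ let $[N]^k=((q+1)^r,q^{k-r})$ with $q=\lfloor N/k\rfloor$, $r=N \bmod k$, be the partition of $N$ into $k$ parts that differ by at most $1$. A partition of $2n$ is said to be of type (P1)-(P9) if (up to the order of its parts) it has the respective form below for some integers satisfying the listed constraints. In (P2)-(P9) the condition $0\le z\le n-1$ is always required; where $l$ occurs, $\alpha=\lceil\frac{n+z}{l+2z}\rceil$ and $\beta=\alpha(l+2z)-(n+z)$. - (P1) $[2n]^s$, $1\le s\le 2n$. - (P2) $([n+m]^{m+z},[n-m]^{l-m+z})$, where either $0<2m\le l<n-z$ and $\lceil\frac{n+m}{m+z}\rceil\ge\lceil\frac{n-m}{l-m+z}\rceil+1$, or $0<m<n-z$ and $l=n-z$. - (P3) $([n+\alpha']^{m+z},[n-\alpha']^{l-m+z})$,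 where $0<m\le l<n-z$, $l<2m$, $n+l-m>\alpha(l+2z)$, $\alpha'=l-m+(2m-l)\alpha$. - (P4) $([n+\alpha'']^{l-m+z},[n-\alpha'']^{m+z})$, where $0<m\le l<n-z$, $l<2m$, $n+m+2z\le\alpha(l+2z)<n+l+z$, $\alpha''=m-(2m-l)\alpha$. - (P5) $([n]^{z+1},[n]^{m+z})$, where $2\le m\le n-z$. - (P6) $((2\alpha)^{l-\beta},(2\alpha-1)^{2z},(2\alpha-2)^{\beta})$, where either $0<m\le l<n-z$, $l<2m$, $\max\{l-m-z,0\}\le\beta<\min\{m+z,l\}$, or $0\le\beta<l<m\le n-z$. - (P7) $((2\alpha-1)^{2l-m+z-\beta},(2\alpha-2)^{2m-l+2z},(2\alpha-3)^{\beta-m-z})$, where $0<m\le l<n-z$, $l<2m$, $\max\{m+z,l\}\le\beta<\min\{2l-m+z,l+2z\}$. - (P8) $([n+\gamma']^{m+z-t},[n-\gamma']^{m+z+t})$, where $0<m<\frac{n-z}2$, $\lceil\frac{n+m+2z}{m+z}\rceil=\lceil\frac{n+m}{m+z}\rceil\ge5$, $1\le t\le\min\{m,\,m-n+\lceil\frac{n-m}{m+z}\rceil(m+z)\}$,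 $\gamma'=m-\lceil\frac{n-z}{m+z}\rceil t$. - (P9) $([n+\gamma'']^{m+z+t},[n-\gamma'']^{m+z-t})$, where $0<m<\frac{n-z}2$, $\lceil\frac{n-m}{m+z}\rceil\le\lceil\frac{n-z}{m+z}\rceil$, $\lceil\frac{n+m}{m+z}\rceil\ge4$, $t\ge1$, $n+z+t\le\lceil\frac{n+m}{m+z}\rceil(m+z)\le n+2m+z-t$, $\gamma''=m+\lceil\frac{n-m-2z}{m+z}\rceil t$. Let $n=9$. Then: 1. The partition $(5^3,3)$ of $18$ is of type (P9), with parameters $z=0$, $m=2$, $t=1$, and it is of none of the types (P1)-(P8). 2. Let $F$ be any field and let $B\in\mathcal O_{(9,9)}\subset M_{18}(F)$. If $\mathcal N(B)\cap\mathcal O_{(5^3,3)}\neq\emptyset$, then there are non-zero $p_0,q_0\in F$ with $p_0^2+3p_0q_0^2+q_0^4=0$. 3. The only $p_0,q_0\in\mathbb Q$ with $p_0^2+3p_0q_0^2+q_0^4=0$ are $p_0=q_0=0$. 4. Consequently, for $F=\mathbb Q$ and every $B\in\mathcal O_{(9,9)}$, $\mathcal N(B)\cap\mathcal O_{(5^3,3)}=\emptyset$.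 -/

import Mathlib

namespace NilpotentOrbits

/-! ### Nilpotent orbits and nilpotent centralizers -/

/-- The nilpotent `k × k` Jordan block: ones on the superdiagonal, zeros elsewhere. -/
def jordanBlock (F : Type*) [Field F] (k : ℕ) : Matrix (Fin k) (Fin k) F :=
  Matrix.of fun i j => if (i : ℕ) + 1 = (j : ℕ) then 1 else 0

/-- The block diagonal matrix whose diagonal blocks are the nilpotent Jordan blocks of the sizes
listed in `l`, in that order. -/
def jordanForm (F : Type*) [Field F] (l : List ℕ) :
    Matrix (Σ i : Fin l.length, Fin (l.get i)) (Σ i : Fin l.length, Fin (l.get i)) F :=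
  Matrix.blockDiagonal' fun i => jordanBlock F (l.get i)

/-- The orbit `𝒪_lam` under conjugation by `GL_N(F)`: all `N × N` matrices over `F` that are
similar to the nilpotent matrix in Jordan canonical form whose block sizes are the parts of `lam`
in non-increasing order. The equivalence `e` only numbers the rows and columns of the block matrix
by `0, …, N - 1`; another numbering gives a similar matrix. -/
def nilpotentOrbit (F : Type*) [Field F] {N : ℕ} (lam : N.Partition) :
    Set (Matrix (Fin N) (Fin N) F) :=
  {A | ∃ l : List ℕ, l.SortedGE ∧ (l : Multiset ℕ) = lam.parts ∧
    ∃ (e : (Σ i : Fin l.length, Fin (l.get i)) ≃ Fin N) (g : GL (Fin N) F),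
      A = (g : Matrix (Fin N) (Fin N) F) * Matrix.reindex e e (jordanForm F l) *
        ((g⁻¹ : GL (Fin N) F) : Matrix (Fin N) (Fin N) F)}

/-- The nilpotent centralizer `𝒩(B)`: all nilpotent matrices that commute with `B`. -/
def nilpotentCentralizer {F : Type*} [Field F] {N : ℕ} (B : Matrix (Fin N) (Fin N) F) :
    Set (Matrix (Fin N) (Fin N) F) :=
  {A | A * B = B * A ∧ IsNilpotent A}

/-! ### The types (P1)-(P9) of partitions of `2n` -/

/-- `⌈a / b⌉`. -/
def ceilQuot (a b : ℤ) : ℤ := ⌈(a : ℚ) / (b : ℚ)⌉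

/-- The block `v ^ k`, that is, `k` copies of the part `v`. -/
def copies (k v : ℤ) : Multiset ℤ := Multiset.replicate k.toNat v

/-- The almost rectangular partition `[N]^k = ((q+1)^r, q^(k-r))` of `N` into `k` parts, where
`q = ⌊N / k⌋` and `r = N mod k`. -/
def almostRect (N k : ℤ) : Multiset ℤ :=
  copies (N % k) (N / k + 1) + copies (k - N % k) (N / k)

/-- The parts of a partition as a multiset of integers. -/
def intParts {N : ℕ} (lam : N.Partition) : Multiset ℤ := lam.parts.map fun i => (i : ℤ)

/-- `α = ⌈(n + z) / (l + 2z)⌉`. -/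
def alphaParam (n z l : ℤ) : ℤ := ceilQuot (n + z) (l + 2 * z)

/-- `β = α (l + 2z) - (n + z)`. -/
def betaParam (n z l : ℤ) : ℤ := alphaParam n z l * (l + 2 * z) - (n + z)

/-- Type (P1). -/
def IsTypeP1 (n : ℕ) (lam : (2 * n).Partition) : Prop :=
  ∃ s : ℤ, 1 ≤ s ∧ s ≤ 2 * n ∧ intParts lam = almostRect (2 * n) s

/-- Type (P2). -/
def IsTypeP2 (n : ℕ) (lam : (2 * n).Partition) : Prop :=
  ∃ z m l : ℤ, 0 ≤ z ∧ z ≤ n - 1 ∧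
    ((0 < 2 * m ∧ 2 * m ≤ l ∧ l < n - z ∧
        ceilQuot (n + m) (m + z) ≥ ceilQuot (n - m) (l - m + z) + 1) ∨
      (0 < m ∧ m < n - z ∧ l = n - z)) ∧
    intParts lam = almostRect (n + m) (m + z) + almostRect (n - m) (l - m + z)

/-- Type (P3), with `α' = l - m + (2m - l) α`. -/
def IsTypeP3 (n : ℕ) (lam : (2 * n).Partition) : Prop :=
  ∃ z m l a : ℤ, 0 ≤ z ∧ z ≤ n - 1 ∧ 0 < m ∧ m ≤ l ∧ l < n - z ∧ l < 2 * m ∧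
    n + l - m > alphaParam n z l * (l + 2 * z) ∧
    a = l - m + (2 * m - l) * alphaParam n z l ∧
    intParts lam = almostRect (n + a) (m + z) + almostRect (n - a) (l - m + z)

/-- Type (P4), with `α'' = m - (2m - l) α`. -/
def IsTypeP4 (n : ℕ) (lam : (2 * n).Partition) : Prop :=
  ∃ z m l a : ℤ, 0 ≤ z ∧ z ≤ n - 1 ∧ 0 < m ∧ m ≤ l ∧ l < n - z ∧ l < 2 * m ∧
    n + m + 2 * z ≤ alphaParam n z l * (l + 2 * z) ∧
    alphaParam n z l * (l + 2 * z) < n + l + z ∧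
    a = m - (2 * m - l) * alphaParam n z l ∧
    intParts lam = almostRect (n + a) (l - m + z) + almostRect (n - a) (m + z)

/-- Type (P5). -/
def IsTypeP5 (n : ℕ) (lam : (2 * n).Partition) : Prop :=
  ∃ z m : ℤ, 0 ≤ z ∧ z ≤ n - 1 ∧ 2 ≤ m ∧ m ≤ n - z ∧
    intParts lam = almostRect n (z + 1) + almostRect n (m + z)

/-- Type (P6). -/
def IsTypeP6 (n : ℕ) (lam : (2 * n).Partition) : Prop :=
  ∃ z m l a b : ℤ, a = alphaParam n z l ∧ b = betaParam n z l ∧ 0 ≤ z ∧ z ≤ n - 1 ∧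
    ((0 < m ∧ m ≤ l ∧ l < n - z ∧ l < 2 * m ∧
        max (l - m - z) 0 ≤ b ∧ b < min (m + z) l) ∨
      (0 ≤ b ∧ b < l ∧ l < m ∧ m ≤ n - z)) ∧
    intParts lam = copies (l - b) (2 * a) + copies (2 * z) (2 * a - 1) + copies b (2 * a - 2)

/-- Type (P7). -/
def IsTypeP7 (n : ℕ) (lam : (2 * n).Partition) : Prop :=
  ∃ z m l a b : ℤ, a = alphaParam n z l ∧ b = betaParam n z l ∧ 0 ≤ z ∧ z ≤ n - 1 ∧
    0 < m ∧ m ≤ l ∧ l < n - z ∧ l < 2 * m ∧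
    max (m + z) l ≤ b ∧ b < min (2 * l - m + z) (l + 2 * z) ∧
    intParts lam = copies (2 * l - m + z - b) (2 * a - 1) +
      copies (2 * m - l + 2 * z) (2 * a - 2) + copies (b - m - z) (2 * a - 3)

/-- Type (P8), with `γ' = m - ⌈(n - z) / (m + z)⌉ t`. -/
def IsTypeP8 (n : ℕ) (lam : (2 * n).Partition) : Prop :=
  ∃ z m t c : ℤ, 0 ≤ z ∧ z ≤ n - 1 ∧ 0 < m ∧ 2 * m < n - z ∧
    ceilQuot (n + m + 2 * z) (m + z) = ceilQuot (n + m) (m + z) ∧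
    ceilQuot (n + m) (m + z) ≥ 5 ∧
    1 ≤ t ∧ t ≤ min m (m - n + ceilQuot (n - m) (m + z) * (m + z)) ∧
    c = m - ceilQuot (n - z) (m + z) * t ∧
    intParts lam = almostRect (n + c) (m + z - t) + almostRect (n - c) (m + z + t)

/-- Type (P9) with the parameters `z`, `m`, `t`; here `c` is
`γ'' = m + ⌈(n - m - 2z) / (m + z)⌉ t`. -/
def IsTypeP9With (n : ℕ) (lam : (2 * n).Partition) (z m t : ℤ) : Prop :=
  ∃ c : ℤ, 0 ≤ z ∧ z ≤ n - 1 ∧ 0 < m ∧ 2 * m < n - z ∧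
    ceilQuot (n - m) (m + z) ≤ ceilQuot (n - z) (m + z) ∧
    ceilQuot (n + m) (m + z) ≥ 4 ∧ t ≥ 1 ∧
    n + z + t ≤ ceilQuot (n + m) (m + z) * (m + z) ∧
    ceilQuot (n + m) (m + z) * (m + z) ≤ n + 2 * m + z - t ∧
    c = m + ceilQuot (n - m - 2 * z) (m + z) * t ∧
    intParts lam = almostRect (n + c) (m + z + t) + almostRect (n - c) (m + z - t)

/-- Type (P9). -/
def IsTypeP9 (n : ℕ) (lam : (2 * n).Partition) : Prop :=
  ∃ z m t : ℤ, IsTypeP9With n lam z m t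

/-! ### The two partitions of `18 = 2 · 9` -/

/-- The partition `(9, 9)`. -/
def partition99 : (2 * 9).Partition where
  parts := {9, 9}
  parts_pos := by simp
  parts_sum := by decide

/-- The partition `(5³, 3) = (5, 5, 5, 3)`. -/
def partition5553 : (2 * 9).Partition where
  parts := {5, 5, 5, 3}
  parts_pos := by simp
  parts_sum := by decide

end NilpotentOrbits

namespace NilpotentOrbits

open PowerSeries

/-! The types are settled by a finite search: every type bounds its parameters, and `ceilQuot`
becomes integer division, so the kernel can check all cases.

For the equation, take `B` to be two Jordan blocks of size 9. Its centralizer is the image of the 2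
× 2 matrices over `F⟦X⟧`, read modulo `X ^ 9`, so a commuting `A` lifts to some `P`. Membership of
`A` in the orbit of (5³,3) enters only through `A ^ 5 = 0`, rank `A` = 14 and rank `A ^ 4` = 3. Over
the discrete valuation ring `F⟦X⟧`, ranks are read off the Smith form (`rank_blockEval_X_pow_smul`),
and they force `P` to have a unit entry and determinant δ = X⁴w with w a unit
(`exists_not_X_dvd_and_det_eq`).

With τ the trace, Cayley–Hamilton gives P⁵ = (τ⁴ − 3τ²δ + δ²)P − δ(τ³ − 2τδ). Since P⁵ vanishes
modulo X⁹ and P has a unit entry, divisibility of the scalar term passes to the coefficient of P.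
This gives first X ∣ τ, then τ = X²t, and finally X⁹ ∣ X⁸(t⁴ − 3t²w + w²). The constant coefficients
satisfy t₀⁴ − 3t₀²w₀ + w₀² = 0, which is the equation for p₀ = −w₀, q₀ = t₀. Its discriminant
contains 5, so over ℚ only the zero solution remains. -/

/-! ### The partition (5³,3) and the types (P1)–(P9). -/

/-- Integer form of `ceilQuot`, for non-negative denominators. -/
theorem ceilQuot_eq_neg_ediv (a b : ℤ) (hb : 0 ≤ b) : ceilQuot a b = -((-a) / b) := by
  obtain ⟨k, rfl⟩ := Int.eq_ofNat_of_zero_le hb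
  have := Rat.ceil_intCast_div_natCast a k
  simpa [ceilQuot] using this

theorem intParts_partition5553 : intParts partition5553 = {5, 5, 5, 3} := rfl

theorem isTypeP9With_partition5553 : IsTypeP9With 9 partition5553 0 2 1 := by
  -- γ'' = 2 + ⌈7/2⌉ · 1 = 6, so the two blocks are [15]³ = (5³) and [3]¹ = (3).
  refine ⟨6, ?_⟩
  rw [intParts_partition5553]
  simp only [ceilQuot_eq_neg_ediv _ (2 + 0) (by norm_num)]
  decide

theorem not_isTypeP1_partition5553 : ¬ IsTypeP1 9 partition5553 := by
  rintro ⟨s, h1, h2, h⟩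
  rw [intParts_partition5553] at h
  have key : ∀ s ∈ Finset.Icc (1 : ℤ) 18, ({5, 5, 5, 3} : Multiset ℤ) ≠ almostRect 18 s := by
    decide +kernel
  exact key s (Finset.mem_Icc.2 ⟨h1, by simpa using h2⟩) h

theorem not_isTypeP2_partition5553 : ¬ IsTypeP2 9 partition5553 := by
  rintro ⟨z, m, l, hz, hz', hc, h⟩
  rw [intParts_partition5553] at h
  have key : ∀ z ∈ Finset.Icc (0 : ℤ) 8, ∀ m ∈ Finset.Icc (1 : ℤ) 9, ∀ l ∈ Finset.Icc (0 : ℤ) 9,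
      ((2 * m ≤ l ∧ -((-(9 + m)) / (m + z)) ≥ -((-(9 - m)) / (l - m + z)) + 1) ∨
        (m < 9 - z ∧ l = 9 - z)) →
      ({5, 5, 5, 3} : Multiset ℤ) ≠ almostRect (9 + m) (m + z) + almostRect (9 - m) (l - m + z) := by
    decide +kernel
  push_cast at *
  refine key z (by simp; omega) m (by simp; omega) l (by simp; omega) ?_ h
  rcases hc with ⟨h1, h2, h3, h4⟩ | ⟨h1, h2, h3⟩
  · rw [ceilQuot_eq_neg_ediv _ _ (by omega), ceilQuot_eq_neg_ediv _ _ (by omega)] at h4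
    exact Or.inl ⟨h2, h4⟩
  · exact Or.inr ⟨h2, h3⟩

theorem not_isTypeP3_partition5553 : ¬ IsTypeP3 9 partition5553 := by
  rintro ⟨z, m, l, a, hz, hz', hm, hml, hl, hlm, hc, rfl, h⟩
  rw [intParts_partition5553] at h
  -- Quantifying over a singleton gives α a name while keeping the statement decidable.
  have key : ∀ z ∈ Finset.Icc (0 : ℤ) 8, ∀ m ∈ Finset.Icc (1 : ℤ) 9, ∀ l ∈ Finset.Icc (1 : ℤ) 9,
      m ≤ l → l < 9 - z → l < 2 * m → ∀ a ∈ ({-((-(9 + z)) / (l + 2 * z))} : Finset ℤ),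
      9 + l - m > a * (l + 2 * z) →
      ({5, 5, 5, 3} : Multiset ℤ) ≠ almostRect (9 + (l - m + (2 * m - l) * a)) (m + z) +
        almostRect (9 - (l - m + (2 * m - l) * a)) (l - m + z) := by
    decide +kernel
  push_cast at *
  refine key z (by simp; omega) m (by simp; omega) l (by simp; omega) hml hl hlm (alphaParam 9 z l)
    ?_ hc h
  rw [alphaParam, ceilQuot_eq_neg_ediv _ _ (by omega), Finset.mem_singleton]

theorem not_isTypeP4_partition5553 : ¬ IsTypeP4 9 partition5553 := by
  rintro ⟨z, m, l, a, hz, hz', hm, hml, hl, hlm, hc, hc', rfl, h⟩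
  rw [intParts_partition5553] at h
  have key : ∀ z ∈ Finset.Icc (0 : ℤ) 8, ∀ m ∈ Finset.Icc (1 : ℤ) 9, ∀ l ∈ Finset.Icc (1 : ℤ) 9,
      m ≤ l → l < 9 - z → l < 2 * m → ∀ a ∈ ({-((-(9 + z)) / (l + 2 * z))} : Finset ℤ),
      9 + m + 2 * z ≤ a * (l + 2 * z) → a * (l + 2 * z) < 9 + l + z →
      ({5, 5, 5, 3} : Multiset ℤ) ≠ almostRect (9 + (m - (2 * m - l) * a)) (l - m + z) +
        almostRect (9 - (m - (2 * m - l) * a)) (m + z) := by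
    decide +kernel
  push_cast at *
  refine key z (by simp; omega) m (by simp; omega) l (by simp; omega) hml hl hlm (alphaParam 9 z l)
    ?_ hc hc' h
  rw [alphaParam, ceilQuot_eq_neg_ediv _ _ (by omega), Finset.mem_singleton]

theorem not_isTypeP5_partition5553 : ¬ IsTypeP5 9 partition5553 := by
  rintro ⟨z, m, hz, hz', hm, hm', h⟩
  rw [intParts_partition5553] at h
  have key : ∀ z ∈ Finset.Icc (0 : ℤ) 8, ∀ m ∈ Finset.Icc (2 : ℤ) 9,
      ({5, 5, 5, 3} : Multiset ℤ) ≠ almostRect 9 (z + 1) + almostRect 9 (m + z) := by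
    decide +kernel
  push_cast at *
  exact key z (by simp; omega) m (by simp; omega) h

theorem not_isTypeP6_partition5553 : ¬ IsTypeP6 9 partition5553 := by
  rintro ⟨z, m, l, a, b, ha, hb, hz, hz', hc, h⟩
  rw [intParts_partition5553] at h
  -- The parts do not involve m, and both alternatives imply 0 ≤ β < l, which already suffices.
  have key : ∀ z ∈ Finset.Icc (0 : ℤ) 8, ∀ l ∈ Finset.Icc (1 : ℤ) 9,
      ∀ a ∈ ({-((-(9 + z)) / (l + 2 * z))} : Finset ℤ),
      ∀ b ∈ ({a * (l + 2 * z) - (9 + z)} : Finset ℤ), 0 ≤ b → b < l →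
      ({5, 5, 5, 3} : Multiset ℤ) ≠
        copies (l - b) (2 * a) + copies (2 * z) (2 * a - 1) + copies b (2 * a - 2) := by
    decide +kernel
  push_cast at *
  have hl : 1 ≤ l ∧ l ≤ 9 ∧ 0 ≤ b ∧ b < l := by omega
  refine key z (by simp; omega) l (by simp; omega) a ?_ b ?_ hl.2.2.1 hl.2.2.2 h
  · rw [ha, alphaParam, ceilQuot_eq_neg_ediv _ _ (by omega), Finset.mem_singleton]
  · rw [hb, ha, betaParam, Finset.mem_singleton]

theorem not_isTypeP7_partition5553 : ¬ IsTypeP7 9 partition5553 := by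
  rintro ⟨z, m, l, a, b, ha, hb, hz, hz', hm, hml, hl, hlm, hc, hc', h⟩
  rw [intParts_partition5553] at h
  have key : ∀ z ∈ Finset.Icc (0 : ℤ) 8, ∀ m ∈ Finset.Icc (1 : ℤ) 9, ∀ l ∈ Finset.Icc (1 : ℤ) 9,
      m ≤ l → l < 9 - z → l < 2 * m → ∀ a ∈ ({-((-(9 + z)) / (l + 2 * z))} : Finset ℤ),
      ∀ b ∈ ({a * (l + 2 * z) - (9 + z)} : Finset ℤ),
      max (m + z) l ≤ b → b < min (2 * l - m + z) (l + 2 * z) →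
      ({5, 5, 5, 3} : Multiset ℤ) ≠ copies (2 * l - m + z - b) (2 * a - 1) +
        copies (2 * m - l + 2 * z) (2 * a - 2) + copies (b - m - z) (2 * a - 3) := by
    decide +kernel
  push_cast at *
  refine key z (by simp; omega) m (by simp; omega) l (by simp; omega) hml hl hlm a ?_ b ?_ hc hc' h
  · rw [ha, alphaParam, ceilQuot_eq_neg_ediv _ _ (by omega), Finset.mem_singleton]
  · rw [hb, ha, betaParam, Finset.mem_singleton]

theorem not_isTypeP8_partition5553 : ¬ IsTypeP8 9 partition5553 := by
  rintro ⟨z, m, t, c, hz, hz', hm, hm', -, hc, ht, ht', rfl, h⟩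
  rw [intParts_partition5553] at h
  have key : ∀ z ∈ Finset.Icc (0 : ℤ) 8, ∀ m ∈ Finset.Icc (1 : ℤ) 9, ∀ t ∈ Finset.Icc (1 : ℤ) 9,
      2 * m < 9 - z → -((-(9 + m)) / (m + z)) ≥ 5 →
      t ≤ min m (m - 9 + -((-(9 - m)) / (m + z)) * (m + z)) →
      ∀ c ∈ ({m - -((-(9 - z)) / (m + z)) * t} : Finset ℤ),
      ({5, 5, 5, 3} : Multiset ℤ) ≠ almostRect (9 + c) (m + z - t) +
        almostRect (9 - c) (m + z + t) := by
    decide +kernel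
  push_cast at *
  have hle : t ≤ m := ht'.trans (min_le_left _ _)
  simp only [ceilQuot_eq_neg_ediv _ (m + z) (by omega)] at hc ht' h
  exact key z (by simp; omega) m (by simp; omega) t (by simp; omega) hm' hc ht' _
    (Finset.mem_singleton_self _) h

/-! ### Ranks of powers of nilpotent Jordan forms. -/

/-- The rank of a partial permutation matrix is the number of its nonzero rows. -/
theorem rank_partialPerm {F : Type*} [Field F] {m : Type*} [Fintype m] [DecidableEq m]
    (R : m → m → Prop) [DecidableRel R] (hl : ∀ i j j', R i j → R i j' → j = j')
    (hr : ∀ i i' j, R i j → R i' j → i = i') :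
    (Matrix.of fun i j => if R i j then (1 : F) else 0).rank =
      Fintype.card {i // ∃ j, R i j} := by
  classical
  set M : Matrix m m F := Matrix.of fun i j => if R i j then (1 : F) else 0 with hM
  -- M Mᵀ is the diagonal projection onto the nonzero rows. As M Mᵀ M = M, it has the same rank as
  -- M.
  have h1 : M * M.transpose = Matrix.diagonal fun i => if ∃ j, R i j then (1 : F) else 0 := by
    ext i i'
    rw [Matrix.mul_apply, Matrix.diagonal_apply]
    simp only [hM, Matrix.transpose_apply, Matrix.of_apply, mul_ite, mul_one, mul_zero]
    by_cases h : ∃ j, R i j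
    · obtain ⟨j, hj⟩ := h
      rw [Finset.sum_eq_single j]
      · by_cases hi : i = i'
        · subst hi; simp [hj, show ∃ j, R i j from ⟨j, hj⟩]
        · simp [hi, show ¬ R i' j from fun h => hi (hr _ _ _ hj h)]
      · intro b _ hb
        have : ¬ R i b := fun h => hb (hl _ _ _ h hj)
        simp [this]
      · simp
    · have h' : ∀ j, ¬ R i j := fun j hj => h ⟨j, hj⟩
      simp [h']
  have h2 : M * M.transpose * M = M := by
    rw [h1]
    ext i j
    rw [Matrix.diagonal_mul]
    simp only [hM, Matrix.of_apply]
    by_cases h : R i j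
    · simp [h, show ∃ j, R i j from ⟨j, h⟩]
    · simp [h]
  have h3 : M.rank = (M * M.transpose).rank :=
    le_antisymm (by conv_lhs => rw [← h2]
                    exact Matrix.rank_mul_le_left _ _) (Matrix.rank_mul_le_left _ _)
  rw [h3, h1, Matrix.rank_diagonal]
  exact Fintype.card_congr (Equiv.subtypeEquivRight fun i => by simp)

theorem jordanBlock_pow (F : Type*) [Field F] (n k : ℕ) :
    jordanBlock F n ^ k = Matrix.of fun i j : Fin n => if (i : ℕ) + k = (j : ℕ) then 1 else 0 := by
  induction k with
  | zero => ext i j; simp [Matrix.one_apply, Fin.ext_iff]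
  | succ k ih =>
    ext i j
    rw [pow_succ, ih, Matrix.mul_apply]
    simp only [jordanBlock, Matrix.of_apply, mul_ite, mul_one, mul_zero]
    by_cases h : (i : ℕ) + (k + 1) = j
    · rw [if_pos h, Finset.sum_eq_single ⟨i + k, by omega⟩]
      · simp; omega
      · intro b _ hb
        rw [Ne, Fin.ext_iff] at hb
        simp only [ite_eq_right_iff]
        simp only at hb
        omega
      · simp
    · rw [if_neg h]
      refine Finset.sum_eq_zero fun b _ => ?_
      simp only [ite_eq_right_iff]
      omega

theorem jordanBlock_pow_self (F : Type*) [Field F] (n : ℕ) : jordanBlock F n ^ n = 0 := by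
  rw [jordanBlock_pow]
  ext i j
  simp only [Matrix.of_apply, Matrix.zero_apply, ite_eq_right_iff]
  omega

theorem jordanForm_pow (F : Type*) [Field F] (l : List ℕ) (k : ℕ) :
    jordanForm F l ^ k = Matrix.of fun p q =>
      if p.1 = q.1 ∧ (p.2 : ℕ) + k = (q.2 : ℕ) then 1 else 0 := by
  rw [jordanForm, ← Matrix.blockDiagonal'_pow]
  ext ⟨i, r⟩ ⟨j, s⟩
  by_cases h : i = j
  · subst h
    rw [Matrix.blockDiagonal'_apply_eq, Pi.pow_apply, jordanBlock_pow]
    simp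
  · simp [Matrix.blockDiagonal'_apply, h]

theorem rank_jordanForm_pow (F : Type*) [Field F] (l : List ℕ) (k : ℕ) :
    (jordanForm F l ^ k).rank =
      Fintype.card {p : Σ i : Fin l.length, Fin (l.get i) // (p.2 : ℕ) + k < l.get p.1} := by
  rw [jordanForm_pow, rank_partialPerm
    (fun p q : Σ i : Fin l.length, Fin (l.get i) => p.1 = q.1 ∧ (p.2 : ℕ) + k = (q.2 : ℕ))]
  · refine Fintype.card_congr (Equiv.subtypeEquivRight ?_)
    rintro ⟨i, r⟩
    constructor
    · rintro ⟨⟨j, s⟩, h, h'⟩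
      obtain rfl : i = j := h
      simp only at h' ⊢
      omega
    · intro h
      exact ⟨⟨i, ⟨r + k, h⟩⟩, rfl, rfl⟩
  · rintro ⟨i, r⟩ ⟨j, s⟩ ⟨j', s'⟩ ⟨h1, h2⟩ ⟨h3, h4⟩
    obtain rfl : i = j := h1
    obtain rfl : i = j' := h3
    simp only at h2 h4
    rw [Fin.ext (h2.symm.trans h4)]
  · rintro ⟨i, r⟩ ⟨j, s⟩ ⟨j', s'⟩ ⟨h1, h2⟩ ⟨h3, h4⟩
    obtain rfl : i = j' := h1
    obtain rfl : j = i := h3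
    simp only at h2 h4
    have : (r : ℕ) = s := by omega
    rw [Fin.ext this]

theorem eq_of_sorted_of_coe_eq {l l' : List ℕ} (hl : l.SortedGE) (hl' : l'.SortedGE)
    (h : (l : Multiset ℕ) = l') : l = l' :=
  List.Perm.eq_of_pairwise' hl.pairwise hl'.pairwise (Multiset.coe_eq_coe.1 h)

/-- The sorted list of parts is unique, so the list hidden in the orbit may be replaced by an
explicit one. -/
theorem exists_conj_of_mem_nilpotentOrbit {F : Type*} [Field F] {N : ℕ} {lam : N.Partition}
    {A : Matrix (Fin N) (Fin N) F} (hA : A ∈ nilpotentOrbit F lam) {l : List ℕ}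
    (hl : l.SortedGE) (hlam : (l : Multiset ℕ) = lam.parts) :
    ∃ (e : (Σ i : Fin l.length, Fin (l.get i)) ≃ Fin N) (g : GL (Fin N) F),
      A = (g : Matrix (Fin N) (Fin N) F) * Matrix.reindex e e (jordanForm F l) *
        ((g⁻¹ : GL (Fin N) F) : Matrix (Fin N) (Fin N) F) := by
  obtain ⟨l', hs, hp, h⟩ := hA
  obtain rfl := eq_of_sorted_of_coe_eq hs hl (hp.trans hlam.symm)
  exact h

theorem conj_reindex_pow {F : Type*} [Field F] {m n : Type*} [Fintype m] [DecidableEq m]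
    [Fintype n] [DecidableEq n] (e : m ≃ n) (g : GL n F) (J : Matrix m m F) (k : ℕ) :
    ((g : Matrix n n F) * Matrix.reindex e e J * ((g⁻¹ : GL n F) : Matrix n n F)) ^ k =
      (g : Matrix n n F) * Matrix.reindex e e (J ^ k) * ((g⁻¹ : GL n F) : Matrix n n F) := by
  rw [← Matrix.coe_reindexAlgEquiv F F, map_pow]
  exact Units.conj_pow g _ k

theorem rank_conj_reindex {F : Type*} [Field F] {m n : Type*} [Fintype m] [DecidableEq m]
    [Fintype n] [DecidableEq n] (e : m ≃ n) (g : GL n F) (J : Matrix m m F) :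
    ((g : Matrix n n F) * Matrix.reindex e e J * ((g⁻¹ : GL n F) : Matrix n n F)).rank =
      J.rank := by
  rw [Matrix.rank_mul_eq_left_of_isUnit_det _ _ ((Matrix.isUnit_iff_isUnit_det _).1 (g⁻¹).isUnit),
    Matrix.rank_mul_eq_right_of_isUnit_det _ _ ((Matrix.isUnit_iff_isUnit_det _).1 g.isUnit),
    Matrix.rank_reindex]

/-- A block of size s contributes max(s − k, 0) to the rank of the k-th power: 14 = 4 + 4 + 4 + 2
and 3 = 1 + 1 + 1 + 0. -/
theorem pow_eq_zero_and_rank_of_mem_orbit5553 {F : Type*} [Field F]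
    {A : Matrix (Fin (2 * 9)) (Fin (2 * 9)) F} (hA : A ∈ nilpotentOrbit F partition5553) :
    A ^ 5 = 0 ∧ A.rank = 14 ∧ (A ^ 4).rank = 3 := by
  obtain ⟨e, g, h⟩ := exists_conj_of_mem_nilpotentOrbit hA (l := [5, 5, 5, 3]) (by decide) rfl
  refine ⟨?_, ?_, ?_⟩
  · rw [h, conj_reindex_pow, jordanForm_pow]
    have : (Matrix.of fun p q : Σ i : Fin [5, 5, 5, 3].length, Fin ([5, 5, 5, 3].get i) =>
        if p.1 = q.1 ∧ (p.2 : ℕ) + 5 = (q.2 : ℕ) then (1 : F) else 0) = 0 := by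
      ext p q
      have : ∀ p q : Σ i : Fin [5, 5, 5, 3].length, Fin ([5, 5, 5, 3].get i),
        ¬ (p.1 = q.1 ∧ (p.2 : ℕ) + 5 = (q.2 : ℕ)) := by decide
      rw [Matrix.of_apply, if_neg (this p q), Matrix.zero_apply]
    rw [this]
    simp
  · rw [h, rank_conj_reindex, ← pow_one (jordanForm F _), rank_jordanForm_pow]
    decide
  · rw [h, conj_reindex_pow, rank_conj_reindex, rank_jordanForm_pow]
    decide

/-! ### The centralizer of two equal Jordan blocks as 2 × 2 matrices over `F⟦X⟧`. -/

/-- The algebra homomorphism `F⟦X⟧ → M_n(F)` which sends `X` to the nilpotent Jordan block. -/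
noncomputable def jordanEval (F : Type*) [Field F] (n : ℕ) :
    F⟦X⟧ →+* Matrix (Fin n) (Fin n) F where
  toFun f := Polynomial.aeval (jordanBlock F n) (trunc n f)
  map_zero' := by simp
  map_add' f g := by simp
  map_one' := by
    rcases n with - | n
    · exact Subsingleton.elim _ _
    · simp
  map_mul' f g := by
    -- Truncation is multiplicative only modulo `X ^ n`, and the n-th power of the Jordan block is
    -- zero.
    have h : (Polynomial.X : Polynomial F) ^ n ∣ trunc n (f * g) - trunc n f * trunc n g := by
      rw [Polynomial.X_pow_dvd_iff]
      intro d hd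
      rw [Polynomial.coeff_sub, coeff_trunc, if_pos hd, coeff_mul_eq_coeff_trunc_mul_trunc f g hd,
        ← Polynomial.coe_mul, Polynomial.coeff_coe, sub_self]
    obtain ⟨q, hq⟩ := h
    rw [← map_mul, ← sub_eq_zero, ← map_sub, hq, map_mul, map_pow, Polynomial.aeval_X,
      jordanBlock_pow_self, zero_mul]

theorem jordanEval_apply {F : Type*} [Field F] {n : ℕ} (f : F⟦X⟧) (i j : Fin n) :
    jordanEval F n f i j = if (i : ℕ) ≤ j then coeff ((j : ℕ) - i) f else 0 := by
  change Polynomial.aeval (jordanBlock F n) (trunc n f) i j = _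
  rw [Polynomial.aeval_eq_sum_range' (show (trunc n f).natDegree < n by
    obtain ⟨k, rfl⟩ := Nat.exists_eq_succ_of_ne_zero (Nat.ne_of_gt i.pos)
    exact natDegree_trunc_lt f k), Matrix.sum_apply]
  simp only [Matrix.smul_apply, jordanBlock_pow, Matrix.of_apply, smul_eq_mul, mul_ite, mul_one,
    mul_zero]
  split_ifs with h
  · rw [Finset.sum_eq_single ((j : ℕ) - i), if_pos (by omega), coeff_trunc, if_pos (by omega)]
    · intro b _ hb
      rw [if_neg (by omega)]
    · intro h
      simp at h
      omega
  · exact Finset.sum_eq_zero fun k _ => if_neg (by omega)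

theorem jordanEval_X_pow (F : Type*) [Field F] (n k : ℕ) :
    jordanEval F n (X ^ k) = jordanBlock F n ^ k := by
  ext i j
  rw [jordanEval_apply, jordanBlock_pow, coeff_X_pow]
  simp only [Matrix.of_apply]
  split_ifs <;> first | rfl | omega

theorem X_pow_dvd_of_jordanEval_eq_zero {F : Type*} [Field F] {n : ℕ} {f : F⟦X⟧}
    (h : jordanEval F n f = 0) : X ^ n ∣ f := by
  rw [X_pow_dvd_iff]
  intro m hm
  have := congr_fun₂ h ⟨0, by omega⟩ ⟨m, hm⟩
  rw [jordanEval_apply] at this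
  simpa using this

/-- A matrix commuting with the nilpotent Jordan block is a power series in it. -/
theorem exists_jordanEval_eq_of_commute {F : Type*} [Field F] {n : ℕ}
    {C : Matrix (Fin n) (Fin n) F} (h : Commute C (jordanBlock F n)) :
    ∃ f : F⟦X⟧, jordanEval F n f = C := by
  rcases n with - | n
  · exact ⟨0, Subsingleton.elim _ _⟩
  -- The coefficients are the entries of row 0. Row 0 of Jⁱ is the i-th unit vector, so row 0 of C
  -- Jⁱ = Jⁱ C says that row i of C is row 0 shifted by i.
  refine ⟨PowerSeries.mk fun k => if hk : k < n + 1 then C 0 ⟨k, hk⟩ else 0, ?_⟩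
  ext i j
  have hp := congr_fun₂ (h.pow_right (i : ℕ)).eq 0 j
  rw [jordanBlock_pow, Matrix.mul_apply, Matrix.mul_apply] at hp
  simp only [Matrix.of_apply, mul_ite, mul_one, mul_zero, ite_mul, one_mul, zero_mul] at hp
  rw [jordanEval_apply, coeff_mk]
  rw [Finset.sum_eq_single (a := i) (s := Finset.univ)
    (f := fun x : Fin (n + 1) =>
      if ((0 : Fin (n + 1)) : ℕ) + (i : ℕ) = (x : ℕ) then C x j else 0)] at hp
  · rw [if_pos (by simp)] at hp
    rw [← hp]
    split_ifs with h1 h2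
    · rw [Finset.sum_eq_single ⟨(j : ℕ) - i, h2⟩]
      · rw [if_pos]
        simp only
        omega
      · intro b _ hb
        rw [Ne, Fin.ext_iff] at hb
        simp only at hb
        exact if_neg (by omega)
      · simp
    · omega
    · exact (Finset.sum_eq_zero fun b _ => if_neg (by omega)).symm
  · intro b _ hb
    rw [Ne, Fin.ext_iff] at hb
    exact if_neg (by simp; omega)
  · simp

/-- The ring homomorphism from the `2 × 2` matrices over `F⟦X⟧` onto the centralizer of the nilpotent
matrix with two Jordan blocks of size `n`. -/
noncomputable def blockEval (F : Type*) [Field F] (n : ℕ) :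
    Matrix (Fin 2) (Fin 2) F⟦X⟧ →+* Matrix (Fin 2 × Fin n) (Fin 2 × Fin n) F :=
  (Matrix.compRingEquiv (Fin 2) (Fin n) F).toRingHom.comp (jordanEval F n).mapMatrix

theorem blockEval_apply {F : Type*} [Field F] {n : ℕ} (P : Matrix (Fin 2) (Fin 2) F⟦X⟧)
    (p q : Fin 2 × Fin n) : blockEval F n P p q = jordanEval F n (P p.1 q.1) p.2 q.2 := rfl

theorem X_pow_dvd_of_blockEval_eq_zero {F : Type*} [Field F] {n : ℕ}
    {P : Matrix (Fin 2) (Fin 2) F⟦X⟧} (h : blockEval F n P = 0) (i j : Fin 2) :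
    X ^ n ∣ P i j := by
  apply X_pow_dvd_of_jordanEval_eq_zero
  ext r s
  exact congr_fun₂ h (i, r) (j, s)

/-- Commuting with diag(J, J) means that each of the four blocks commutes with J, hence is a power
series in J. -/
theorem exists_blockEval_eq_of_commute {F : Type*} [Field F] {n : ℕ}
    {A : Matrix (Fin 2 × Fin n) (Fin 2 × Fin n) F}
    (h : Commute A (blockEval F n (Matrix.diagonal fun _ => X))) :
    ∃ P, blockEval F n P = A := by
  set B := (Matrix.compRingEquiv (Fin 2) (Fin n) F).symm A with hB
  have hc : Commute B (Matrix.diagonal fun _ => jordanBlock F n) := by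
    have hX : blockEval F n (Matrix.diagonal fun _ => X) =
        Matrix.compRingEquiv (Fin 2) (Fin n) F (Matrix.diagonal fun _ => jordanBlock F n) := by
      have hX' := jordanEval_X_pow F n 1
      rw [pow_one, pow_one] at hX'
      ext ⟨i, r⟩ ⟨j, s⟩
      change _ = (Matrix.diagonal fun _ => jordanBlock F n : Matrix (Fin 2) (Fin 2) _) i j r s
      rw [blockEval_apply, Matrix.diagonal_apply, Matrix.diagonal_apply]
      split_ifs
      · rw [hX']
      · rw [map_zero]
    rw [hX] at h
    have hs := h.map (Matrix.compRingEquiv (Fin 2) (Fin n) F).symm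
    rwa [RingEquiv.symm_apply_apply] at hs
  have hb : ∀ i j, ∃ f, jordanEval F n f = B i j := fun i j => by
    apply exists_jordanEval_eq_of_commute
    have := congr_fun₂ hc.eq i j
    rwa [Matrix.mul_diagonal, Matrix.diagonal_mul] at this
  choose P hP using hb
  refine ⟨Matrix.of P, ?_⟩
  ext ⟨i, r⟩ ⟨j, s⟩
  exact congr_fun₂ (hP i j) r s

/-- The image Jᵏ of Xᵏ has n − k nonzero rows; truncated subtraction covers k ≥ n. -/
theorem rank_blockEval_diagonal {F : Type*} [Field F] {n : ℕ} (k : Fin 2 → ℕ) :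
    (blockEval F n (Matrix.diagonal fun i => X ^ k i)).rank = (n - k 0) + (n - k 1) := by
  have h : blockEval F n (Matrix.diagonal fun i => X ^ k i) =
      Matrix.of fun p q : Fin 2 × Fin n =>
        if p.1 = q.1 ∧ (p.2 : ℕ) + k p.1 = (q.2 : ℕ) then (1 : F) else 0 := by
    ext ⟨i, r⟩ ⟨j, s⟩
    rw [blockEval_apply, Matrix.diagonal_apply]
    by_cases hij : i = j
    · subst hij
      simp [jordanEval_X_pow, jordanBlock_pow]
    · simp [hij]
  have hcard : ∀ a, Fintype.card {r : Fin n // (r : ℕ) + a < n} = n - a := fun a => by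
    rw [← Fintype.card_fin (n - a)]
    exact Fintype.card_congr
      { toFun := fun r => ⟨r.1, by have := r.2; omega⟩
        invFun := fun r => ⟨⟨r, by omega⟩, by simp; omega⟩
        left_inv := fun r => rfl
        right_inv := fun r => rfl }
  rw [h, rank_partialPerm
    (fun p q : Fin 2 × Fin n => p.1 = q.1 ∧ (p.2 : ℕ) + k p.1 = (q.2 : ℕ))]
  · rw [← hcard (k 0), ← hcard (k 1), ← Fin.sum_univ_two
      (fun i => Fintype.card {r : Fin n // (r : ℕ) + k i < n}), ← Fintype.card_sigma]
    refine Fintype.card_congr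
      { toFun := fun p => ⟨p.1.1, p.1.2, ?_⟩
        invFun := fun p => ⟨(p.1, p.2.1), (p.1, ⟨(p.2.1 : ℕ) + k p.1, p.2.2⟩), rfl, rfl⟩
        left_inv := fun p => rfl
        right_inv := fun p => rfl }
    obtain ⟨q, -, hq⟩ := p.2
    exact hq ▸ q.2.2
  · rintro ⟨i, r⟩ ⟨j, s⟩ ⟨j', s'⟩ ⟨h1, h2⟩ ⟨h3, h4⟩
    simp only at *
    rw [Prod.mk.injEq, Fin.ext_iff (a := s)]
    exact ⟨h1.symm.trans h3, by omega⟩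
  · rintro ⟨i, r⟩ ⟨j, s⟩ ⟨j', s'⟩ ⟨h1, h2⟩ ⟨h3, h4⟩
    simp only at *
    subst h1 h3
    rw [Prod.mk.injEq, Fin.ext_iff (a := r)]
    exact ⟨rfl, by omega⟩

/-! ### Orders of power series and the Smith form of 2 × 2 matrices. -/

theorem exists_eq_X_pow_mul_unit {F : Type*} [Field F] {f : F⟦X⟧} (hf : f ≠ 0) :
    ∃ (k : ℕ) (w : F⟦X⟧), IsUnit w ∧ f = X ^ k * w := by
  obtain ⟨k, u, h⟩ := IsDiscreteValuationRing.eq_unit_mul_pow_irreducible hf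
    (X_prime (R := F)).irreducible
  exact ⟨k, u, u.isUnit, by rw [h, mul_comm]⟩

theorem eq_of_X_pow_mul_unit_eq {F : Type*} [Field F] {a b : ℕ} {u v : F⟦X⟧} (hu : IsUnit u)
    (hv : IsUnit v) (h : X ^ a * u = X ^ b * v) : a = b := by
  have h1 := congrArg order h
  rw [order_mul, order_mul, order_zero_of_unit hu, order_zero_of_unit hv, order_X_pow, order_X_pow,
    add_zero, add_zero] at h1
  exact_mod_cast h1

theorem isUnit_of_not_X_dvd {F : Type*} [Field F] {f : F⟦X⟧} (h : ¬ X ∣ f) : IsUnit f := by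
  rw [isUnit_iff_constantCoeff, isUnit_iff_ne_zero]
  exact fun h' => h (X_dvd_iff.2 h')

theorem not_X_dvd_of_isUnit {F : Type*} [Field F] {f : F⟦X⟧} (h : IsUnit f) : ¬ X ∣ f :=
  fun h' => X_prime.not_isUnit (isUnit_of_dvd_unit h' h)

/-- Every nonzero matrix over `F⟦X⟧` is a power of `X` times a matrix with a unit entry. -/
theorem exists_eq_X_pow_smul {F : Type*} [Field F] {P : Matrix (Fin 2) (Fin 2) F⟦X⟧}
    (hP : P ≠ 0) : ∃ (a : ℕ) (Q : Matrix (Fin 2) (Fin 2) F⟦X⟧),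
      P = (X ^ a : F⟦X⟧) • Q ∧ ∃ i j, ¬ X ∣ Q i j := by
  classical
  have hex : ∃ n : ℕ, ¬ ∀ i j, X ^ n ∣ P i j := by
    by_contra! hall
    apply hP
    ext i j m
    exact X_pow_dvd_iff.1 (hall (m + 1) i j) m (Nat.lt_succ_self m)
  obtain ⟨a, ha⟩ : ∃ a, Nat.find hex = a + 1 := by
    refine Nat.exists_eq_succ_of_ne_zero fun h0 => ?_
    have := Nat.find_spec hex
    rw [h0] at this
    simp at this
  have hdiv : ∀ i j, X ^ a ∣ P i j := by
    have := Nat.find_min hex (m := a) (by omega)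
    exact not_not.1 this
  choose Q hQ using hdiv
  refine ⟨a, Matrix.of Q, by ext1 i j; simp [hQ], ?_⟩
  have h := Nat.find_spec hex
  rw [ha] at h
  push Not at h
  obtain ⟨i, j, hij⟩ := h
  refine ⟨i, j, fun h => hij ?_⟩
  rw [hQ i j, pow_succ]
  exact mul_dvd_mul_left _ h

theorem exists_smith_of_isUnit_apply_zero {R : Type*} [CommRing R] {Q : Matrix (Fin 2) (Fin 2) R}
    (h : IsUnit (Q 0 0)) : ∃ U V : Matrix (Fin 2) (Fin 2) R,
      U.det = 1 ∧ V.det = 1 ∧ U * Q * V = Matrix.diagonal ![1, Q.det] := by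
  obtain ⟨v, hv⟩ := h.exists_left_inv
  -- The unit pivot is scaled to 1 and clears its row and column. Both factors have determinant 1,
  -- so the remaining entry is the determinant of Q.
  refine ⟨!![v, 0; -Q 1 0, Q 0 0], !![1, -(v * Q 0 1); 0, 1], ?_, ?_, ?_⟩
  · simp [Matrix.det_fin_two, hv]
  · simp [Matrix.det_fin_two]
  · ext i j
    fin_cases i <;> fin_cases j <;>
      simp only [Matrix.mul_apply (N := !![1, -(v * Q 0 1); 0, 1]), Matrix.mul_apply (N := Q),
        Fin.sum_univ_two, Matrix.det_fin_two] <;> simp <;> grind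

/-- Diagonalization of a `2 × 2` matrix with a unit entry. -/
theorem exists_smith_of_isUnit_apply {R : Type*} [CommRing R] {Q : Matrix (Fin 2) (Fin 2) R}
    {i j : Fin 2} (h : IsUnit (Q i j)) : ∃ U V : Matrix (Fin 2) (Fin 2) R,
      U.det = 1 ∧ V.det = 1 ∧ U * Q * V = Matrix.diagonal ![1, Q.det] := by
  -- Row and column swaps carry a sign, to keep the determinant equal to 1.
  obtain ⟨S, hS, hS'⟩ : ∃ S : Matrix (Fin 2) (Fin 2) R, S.det = 1 ∧ IsUnit ((S * Q) 0 j) := by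
    fin_cases i
    · exact ⟨1, by simp, by simpa using h⟩
    · exact ⟨!![0, 1; -1, 0], by simp [Matrix.det_fin_two],
        by simpa [Matrix.mul_apply, Fin.sum_univ_two] using h⟩
  obtain ⟨T, hT, hT'⟩ : ∃ T : Matrix (Fin 2) (Fin 2) R, T.det = 1 ∧ IsUnit ((S * Q * T) 0 0) := by
    fin_cases j
    · exact ⟨1, by simp, by simpa using hS'⟩
    · exact ⟨!![0, -1; 1, 0], by simp [Matrix.det_fin_two],
        by rw [Matrix.mul_apply, Fin.sum_univ_two]; simpa using hS'⟩
  obtain ⟨U, V, hU, hV, hUV⟩ := exists_smith_of_isUnit_apply_zero hT'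
  refine ⟨U * S, T * V, by simp [hU, hS], by simp [hV, hT], ?_⟩
  rw [Matrix.det_mul, Matrix.det_mul, hS, hT, one_mul, mul_one] at hUV
  rw [← hUV]
  simp only [Matrix.mul_assoc]

theorem rank_blockEval_mul_left {F : Type*} [Field F] {n : ℕ}
    {U P : Matrix (Fin 2) (Fin 2) F⟦X⟧} (hU : IsUnit U.det) :
    (blockEval F n (U * P)).rank = (blockEval F n P).rank := by
  rw [map_mul]
  apply Matrix.rank_mul_eq_right_of_isUnit_det
  rw [← Matrix.isUnit_iff_isUnit_det] at hU ⊢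
  exact hU.map _

theorem rank_blockEval_mul_right {F : Type*} [Field F] {n : ℕ}
    {U P : Matrix (Fin 2) (Fin 2) F⟦X⟧} (hU : IsUnit U.det) :
    (blockEval F n (P * U)).rank = (blockEval F n P).rank := by
  rw [map_mul]
  apply Matrix.rank_mul_eq_left_of_isUnit_det
  rw [← Matrix.isUnit_iff_isUnit_det] at hU ⊢
  exact hU.map _

theorem blockEval_congr {F : Type*} [Field F] {n : ℕ} {P Q : Matrix (Fin 2) (Fin 2) F⟦X⟧}
    (h : ∀ i j, X ^ n ∣ P i j - Q i j) : blockEval F n P = blockEval F n Q := by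
  ext p q
  obtain ⟨f, hf⟩ := h p.1 q.1
  rw [blockEval_apply, blockEval_apply, ← sub_eq_zero, ← Matrix.sub_apply, ← map_sub, hf, map_mul,
    jordanEval_X_pow, jordanBlock_pow_self, zero_mul, Matrix.zero_apply]

/-- Up to invertible factors the matrix is diag(Xᵃ, Xᵃ⁺ᵏ) modulo Xⁿ. Knowing the determinant only
modulo Xⁿ lets a zero determinant be treated as k = n, w = 1. -/
theorem rank_blockEval_X_pow_smul {F : Type*} [Field F] {n a k : ℕ}
    {Q : Matrix (Fin 2) (Fin 2) F⟦X⟧} {i j : Fin 2} (hQ : ¬ X ∣ Q i j) {w : F⟦X⟧} (hw : IsUnit w)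
    (hd : X ^ n ∣ Q.det - X ^ k * w) :
    (blockEval F n ((X ^ a : F⟦X⟧) • Q)).rank = (n - a) + (n - (a + k)) := by
  obtain ⟨U, V, hU, hV, h⟩ := exists_smith_of_isUnit_apply (isUnit_of_not_X_dvd hQ)
  have hW : IsUnit (Matrix.diagonal ![1, w]).det := by simpa [Matrix.det_diagonal] using hw
  have hD := rank_blockEval_diagonal (F := F) (n := n) ![a, a + k]
  rw [← rank_blockEval_mul_right hW] at hD
  rw [← rank_blockEval_mul_left (U := U) (by simp [hU]),
    ← rank_blockEval_mul_right (U := V) (by simp [hV]), Matrix.mul_smul, Matrix.smul_mul, h]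
  refine Eq.trans (congrArg Matrix.rank (blockEval_congr fun i j => ?_)) hD
  rw [Matrix.diagonal_mul_diagonal, Matrix.smul_apply, Matrix.diagonal_apply, Matrix.diagonal_apply]
  fin_cases i <;> fin_cases j <;> simp
  rw [pow_add, mul_assoc, ← mul_sub]
  exact hd.mul_left _

/-! ### Cayley–Hamilton and the orders of trace and determinant. -/

/-- Iterating Q² = τQ − δ gives this and the formula for Q⁵. -/
theorem pow_four_fin_two {R : Type*} [CommRing R] (Q : Matrix (Fin 2) (Fin 2) R) :
    Q ^ 4 = (Q.trace ^ 3 - 2 * Q.trace * Q.det) • Q - (Q.det * (Q.trace ^ 2 - Q.det)) • 1 := by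
  rw [Matrix.eta_fin_two Q]
  simp only [pow_succ, pow_zero, one_mul, Matrix.mul_fin_two, Matrix.one_fin_two,
    Matrix.trace_fin_two_of, Matrix.det_fin_two_of]
  ext i j
  fin_cases i <;> fin_cases j <;> simp <;> ring

theorem pow_five_fin_two {R : Type*} [CommRing R] (Q : Matrix (Fin 2) (Fin 2) R) :
    Q ^ 5 = (Q.trace ^ 4 - 3 * Q.trace ^ 2 * Q.det + Q.det ^ 2) • Q -
      (Q.det * (Q.trace ^ 3 - 2 * Q.trace * Q.det)) • 1 := by
  rw [Matrix.eta_fin_two Q]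
  simp only [pow_succ, pow_zero, one_mul, Matrix.mul_fin_two, Matrix.one_fin_two,
    Matrix.trace_fin_two_of, Matrix.det_fin_two_of]
  ext i j
  fin_cases i <;> fin_cases j <;> simp <;> ring

/-- If `X ^ e` divides `Q ^ 5` and the `1`-coefficient of `Q ^ 5` in terms of `Q` and `1`, and `Q`
has a unit entry, then `X ^ e` divides the `Q`-coefficient. -/
theorem X_pow_dvd_coeff_of_dvd_pow_five {F : Type*} [Field F] {e : ℕ}
    {Q : Matrix (Fin 2) (Fin 2) F⟦X⟧} {i j : Fin 2} (hQ : ¬ X ∣ Q i j)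
    (h5 : X ^ e ∣ (Q ^ 5) i j) (hd : X ^ e ∣ Q.det * (Q.trace ^ 3 - 2 * Q.trace * Q.det)) :
    X ^ e ∣ Q.trace ^ 4 - 3 * Q.trace ^ 2 * Q.det + Q.det ^ 2 := by
  rw [← (isUnit_of_not_X_dvd hQ).dvd_mul_right]
  rw [pow_five_fin_two, Matrix.sub_apply, Matrix.smul_apply, Matrix.smul_apply, smul_eq_mul,
    smul_eq_mul] at h5
  simpa using dvd_add h5 (hd.mul_right ((1 : Matrix (Fin 2) (Fin 2) F⟦X⟧) i j))

/-- Modulo X the determinant vanishes, so the coefficient of Q in Q⁵ reduces to τ⁴. -/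
theorem X_dvd_trace {F : Type*} [Field F] {Q : Matrix (Fin 2) (Fin 2) F⟦X⟧} {i j : Fin 2}
    (hQ : ¬ X ∣ Q i j) (h5 : X ∣ (Q ^ 5) i j) (hd : X ∣ Q.det) : X ∣ Q.trace := by
  rw [← pow_one (X : F⟦X⟧)] at h5
  have h := X_pow_dvd_coeff_of_dvd_pow_five hQ h5 (by rw [pow_one]; exact hd.mul_right _)
  rw [pow_one] at h
  have h' : X ∣ Q.trace ^ 4 := by
    have : Q.trace ^ 4 = Q.trace ^ 4 - 3 * Q.trace ^ 2 * Q.det + Q.det ^ 2 +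
      Q.det * (3 * Q.trace ^ 2 - Q.det) := by ring
    rw [this]
    exact dvd_add h (hd.mul_right _)
  exact X_prime.dvd_of_dvd_pow h'

/-- A rank count for fourth powers: the entries of `P ^ 4` have no common factor `X ^ 7`. -/
theorem not_X_pow_seven_dvd_pow_four {F : Type*} [Field F] {P : Matrix (Fin 2) (Fin 2) F⟦X⟧}
    {w : F⟦X⟧} (hw : IsUnit w) (hd : P.det = X ^ 4 * w)
    (h4 : (blockEval F 9 (P ^ 4)).rank = 3) : ¬ ∀ i j, X ^ 7 ∣ (P ^ 4) i j := by
  intro h7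
  have h0 : P ^ 4 ≠ 0 := by
    intro h
    rw [h, map_zero, Matrix.rank_zero] at h4
    omega
  obtain ⟨e, S, hS, i, j, hij⟩ := exists_eq_X_pow_smul h0
  have hdet : X ^ (2 * e) * S.det = X ^ 16 * w ^ 4 := by
    have := congrArg Matrix.det hS
    rw [Matrix.det_pow, hd, Matrix.det_smul, Fintype.card_fin] at this
    rw [pow_mul', ← this]
    ring
  have hS0 : S.det ≠ 0 := by
    rintro h
    rw [h, mul_zero] at hdet
    exact mul_ne_zero (pow_ne_zero _ X_ne_zero) (pow_ne_zero _ hw.ne_zero) hdet.symm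
  obtain ⟨h, v, hv, hSd⟩ := exists_eq_X_pow_mul_unit hS0
  have hsum : 2 * e + h = 16 := by
    rw [hSd, ← mul_assoc, ← pow_add] at hdet
    exact eq_of_X_pow_mul_unit_eq hv (hw.pow 4) hdet
  have hr := rank_blockEval_X_pow_smul (n := 9) (a := e) hij hv (by rw [hSd, sub_self]; exact dvd_zero _)
  rw [← hS, h4] at hr
  have he : 7 ≤ e := by
    by_contra! hlt
    have := h7 i j
    rw [hS, Matrix.smul_apply, smul_eq_mul] at this
    have h2 : (X : F⟦X⟧) ^ (e + 1) ∣ X ^ e * S i j := (pow_dvd_pow _ (by omega)).trans this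
    rw [pow_succ] at h2
    exact hij ((mul_dvd_mul_iff_left (pow_ne_zero _ X_ne_zero)).1 h2)
  -- With 2e + h = 16 and e ≥ 7, the rank is (9 − e) + (9 − (16 − e)) = 2, not 3.
  omega

/-- The rank conditions force a unit entry, and a determinant of order `4`. -/
theorem exists_not_X_dvd_and_det_eq {F : Type*} [Field F] {P : Matrix (Fin 2) (Fin 2) F⟦X⟧}
    (h5 : ∀ i j, X ^ 9 ∣ (P ^ 5) i j) (h1 : (blockEval F 9 P).rank = 14)
    (h4 : (blockEval F 9 (P ^ 4)).rank = 3) :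
    (∃ i j, ¬ X ∣ P i j) ∧ ∃ w, IsUnit w ∧ P.det = X ^ 4 * w := by
  have h0 : P ≠ 0 := by
    rintro rfl
    rw [map_zero, Matrix.rank_zero] at h1
    omega
  obtain ⟨a, Q, rfl, i, j, hij⟩ := exists_eq_X_pow_smul h0
  have hQ0 : Q.det ≠ 0 := by
    intro h
    -- A zero determinant would bound the rank by 9 − a < 14.
    rw [rank_blockEval_X_pow_smul (k := 9) hij isUnit_one (by simp [h])] at h1
    omega
  obtain ⟨k, w, hw, hd⟩ := exists_eq_X_pow_mul_unit hQ0
  rw [rank_blockEval_X_pow_smul (k := k) hij hw (by rw [hd, sub_self]; exact dvd_zero _)] at h1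
  -- Rank 14 exceeds 9 − a, so neither summand is truncated to 0 and 2a + k = 4.
  have hdet : ((X ^ a : F⟦X⟧) • Q).det = X ^ 4 * w := by
    rw [Matrix.det_smul, Fintype.card_fin, hd, ← mul_assoc, ← pow_mul, ← pow_add]
    congr 2
    omega
  have h7 := not_X_pow_seven_dvd_pow_four hw hdet h4
  obtain rfl | rfl | ha : a = 0 ∨ a = 1 ∨ 2 ≤ a := by omega
  · exact ⟨⟨i, j, by simpa using hij⟩, w, hw, hdet⟩
  -- For a = 1, det Q has order 2 and X ∣ tr Q, so both coefficients in the formula for Q⁴ are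
  -- divisible by X³, hence P⁴ = X⁴Q⁴ by X⁷.
  · refine absurd (fun r s => ?_) h7
    obtain rfl : k = 2 := by omega
    have ht : X ∣ Q.trace := by
      refine X_dvd_trace hij ?_ (hd ▸ (dvd_pow_self _ (by norm_num)).mul_right _)
      have h := h5 i j
      rw [pow_one, smul_pow, Matrix.smul_apply, smul_eq_mul, show 9 = 5 + 4 from rfl, pow_add,
        mul_dvd_mul_iff_left (pow_ne_zero _ X_ne_zero)] at h
      exact (dvd_pow_self _ (by norm_num)).trans h
    obtain ⟨t, ht⟩ := ht
    rw [pow_one, smul_pow, pow_four_fin_two, ht, hd, Matrix.smul_apply, Matrix.sub_apply,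
      Matrix.smul_apply, Matrix.smul_apply, smul_eq_mul, smul_eq_mul, smul_eq_mul]
    exact ⟨(t ^ 3 - 2 * t * w) * Q r s - X * w * (t ^ 2 - w) * (1 : Matrix _ _ F⟦X⟧) r s, by ring⟩
  -- For a ≥ 2, already X⁸ divides P⁴.
  · refine absurd (fun r s => ?_) h7
    rw [smul_pow, Matrix.smul_apply, smul_eq_mul, ← pow_mul]
    exact (pow_dvd_pow _ (by omega)).mul_right _

theorem exists_nonzero_solution_of_blockEval {F : Type*} [Field F]
    {P : Matrix (Fin 2) (Fin 2) F⟦X⟧} (h5 : ∀ i j, X ^ 9 ∣ (P ^ 5) i j)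
    (h1 : (blockEval F 9 P).rank = 14) (h4 : (blockEval F 9 (P ^ 4)).rank = 3) :
    ∃ p₀ q₀ : F, p₀ ≠ 0 ∧ q₀ ≠ 0 ∧ p₀ ^ 2 + 3 * p₀ * q₀ ^ 2 + q₀ ^ 4 = 0 := by
  obtain ⟨⟨i, j, hij⟩, w, hw, hd⟩ := exists_not_X_dvd_and_det_eq h5 h1 h4
  have hX : ∀ e, (X : F⟦X⟧) ^ e ≠ 0 := fun e => pow_ne_zero _ X_ne_zero
  obtain ⟨s, hs⟩ : X ∣ P.trace := X_dvd_trace hij ((dvd_pow_self _ (by norm_num)).trans (h5 i j))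
    (hd ▸ (dvd_pow_self _ (by norm_num)).mul_right _)
  -- With τ = Xs and δ = X⁴w, the scalar term δ(τ³ − 2τδ) is divisible by X⁷. Cancelling X⁴ from the
  -- coefficient of P leaves X ∣ s⁴.
  obtain ⟨t, rfl⟩ : X ∣ s := by
    have h7 := X_pow_dvd_coeff_of_dvd_pow_five (e := 7) hij
      ((pow_dvd_pow _ (by norm_num)).trans (h5 i j))
      ⟨w * (s ^ 3 - 2 * s * X * X * w), by rw [hs, hd]; ring⟩
    rw [hs, hd, show (X * s) ^ 4 - 3 * (X * s) ^ 2 * (X ^ 4 * w) + (X ^ 4 * w) ^ 2 =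
      X ^ 4 * (s ^ 4 + X * (X * (X ^ 2 * w ^ 2 - 3 * s ^ 2 * w))) by ring,
      show 7 = 4 + 3 from rfl, pow_add, mul_dvd_mul_iff_left (hX 4)] at h7
    have := (dvd_add_left (dvd_mul_right _ _)).1 ((dvd_pow_self X (by norm_num)).trans h7)
    exact X_prime.dvd_of_dvd_pow this
  -- Now τ = X²t, so the scalar term is divisible by X¹⁰ and the full exponent 9 is available.
  have h9 := X_pow_dvd_coeff_of_dvd_pow_five (e := 9) hij (h5 i j)
      ⟨X * w * (t ^ 3 - 2 * t * w), by rw [hs, hd]; ring⟩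
  rw [hs, hd, show (X * (X * t)) ^ 4 - 3 * (X * (X * t)) ^ 2 * (X ^ 4 * w) + (X ^ 4 * w) ^ 2 =
      X ^ 8 * (t ^ 4 - 3 * t ^ 2 * w + w ^ 2) by ring, pow_succ,
      mul_dvd_mul_iff_left (hX 8), X_dvd_iff] at h9
  simp only [map_add, map_sub, map_mul, map_pow, map_ofNat] at h9
  have hw0 : constantCoeff w ≠ 0 := fun h => not_X_dvd_of_isUnit hw (X_dvd_iff.2 h)
  refine ⟨-constantCoeff w, constantCoeff t, neg_ne_zero.2 hw0, fun h => ?_, ?_⟩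
  -- If t₀ = 0, the equation leaves w₀² = 0, but w is a unit.
  · rw [h] at h9
    simp [hw0] at h9
  · rw [← h9]
    ring

/-! ### Transfer to the orbits, and rational solutions. -/

theorem exists_solution_of_mem_orbits {F : Type*} [Field F]
    {A B : Matrix (Fin (2 * 9)) (Fin (2 * 9)) F} (hB : B ∈ nilpotentOrbit F partition99)
    (hAB : Commute A B) (hA : A ∈ nilpotentOrbit F partition5553) :
    ∃ p₀ q₀ : F, p₀ ≠ 0 ∧ q₀ ≠ 0 ∧ p₀ ^ 2 + 3 * p₀ * q₀ ^ 2 + q₀ ^ 4 = 0 := by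
  obtain ⟨h5, h1, h4⟩ := pow_eq_zero_and_rank_of_mem_orbit5553 hA
  obtain ⟨e, g, hg⟩ := exists_conj_of_mem_nilpotentOrbit hB (l := [9, 9]) (by decide) rfl
  have hget : ∀ i : Fin [9, 9].length, [9, 9].get i = 9 := by decide
  let σ : (Σ i : Fin [9, 9].length, Fin ([9, 9].get i)) ≃ Fin 2 × Fin 9 :=
    { toFun := fun p => (p.1, Fin.cast (hget p.1) p.2)
      invFun := fun q => ⟨q.1, Fin.cast (hget q.1).symm q.2⟩
      left_inv := fun p => rfl
      right_inv := fun q => rfl }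
  let ε : Fin (2 * 9) ≃ Fin 2 × Fin 9 := e.symm.trans σ
  have hσ : Matrix.reindex σ σ (jordanForm F [9, 9]) =
      blockEval F 9 (Matrix.diagonal fun _ => X) := by
    ext ⟨i, r⟩ ⟨j, s⟩
    rw [← pow_one (jordanForm F _), jordanForm_pow, blockEval_apply, Matrix.diagonal_apply,
      ← pow_one X]
    change (if i = j ∧ (r : ℕ) + 1 = s then (1 : F) else 0) = _
    by_cases h : i = j
    · rw [if_pos h, jordanEval_X_pow, jordanBlock_pow]
      simp [h]
    · rw [if_neg h, map_zero]
      simp [h]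
  -- Conjugating by g moves B to its Jordan form; C is A in that basis, with the same ranks of
  -- powers.
  let C : Matrix (Fin (2 * 9)) (Fin (2 * 9)) F := ((g⁻¹ : GL _ F) : Matrix _ _ F) * A * (g : Matrix _ _ F)
  have hC : ∀ k, C ^ k = ((g⁻¹ : GL _ F) : Matrix _ _ F) * A ^ k * (g : Matrix _ _ F) := fun k =>
    Units.conj_pow' g A k
  have hCr : ∀ k, (C ^ k).rank = (A ^ k).rank := fun k => by
    rw [hC, Matrix.rank_mul_eq_left_of_isUnit_det _ _
      ((Matrix.isUnit_iff_isUnit_det _).1 g.isUnit), Matrix.rank_mul_eq_right_of_isUnit_det _ _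
      ((Matrix.isUnit_iff_isUnit_det _).1 (g⁻¹).isUnit)]
  have hcomm : Commute C (Matrix.reindex e e (jordanForm F [9, 9])) := by
    have hB' : Matrix.reindex e e (jordanForm F [9, 9]) =
        ((g⁻¹ : GL _ F) : Matrix _ _ F) * B * (g : Matrix _ _ F) := by
      rw [hg, ← mul_assoc, ← mul_assoc, Units.inv_mul, one_mul, mul_assoc, Units.inv_mul, mul_one]
    rw [hB', Commute, SemiconjBy]
    calc _ = ((g⁻¹ : GL _ F) : Matrix _ _ F) * (A * B) * (g : Matrix _ _ F) := by
          simp only [C, mul_assoc, Units.mul_inv_cancel_left]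
      _ = ((g⁻¹ : GL _ F) : Matrix _ _ F) * (B * A) * (g : Matrix _ _ F) := by rw [hAB.eq]
      _ = _ := by simp only [C, mul_assoc, Units.mul_inv_cancel_left]
  have hcomm' : Commute (Matrix.reindexAlgEquiv F F ε C)
      (blockEval F 9 (Matrix.diagonal fun _ => X)) := by
    have h := hcomm.map (Matrix.reindexAlgEquiv F F ε)
    have hε : Matrix.reindexAlgEquiv F F ε (Matrix.reindex e e (jordanForm F [9, 9])) =
        blockEval F 9 (Matrix.diagonal fun _ => X) := by
      rw [← hσ, Matrix.coe_reindexAlgEquiv]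
      ext p q
      simp [ε]
    rwa [hε] at h
  obtain ⟨P, hP⟩ := exists_blockEval_eq_of_commute hcomm'
  have hPk : ∀ k, blockEval F 9 (P ^ k) = Matrix.reindex ε ε (C ^ k) := fun k => by
    rw [map_pow, hP, ← map_pow, Matrix.coe_reindexAlgEquiv]
  have hPr : ∀ k, (blockEval F 9 (P ^ k)).rank = (A ^ k).rank := fun k => by
    rw [hPk, Matrix.rank_reindex, hCr]
  refine exists_nonzero_solution_of_blockEval (P := P) (fun i j => ?_) ?_ ?_
  · apply X_pow_dvd_of_blockEval_eq_zero
    rw [hPk, hC, h5]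
    simp
  · rw [← pow_one P, hPr, pow_one, h1]
  · rw [hPr, h4]

theorem eq_zero_of_rat_solution {p q : ℚ} (h : p ^ 2 + 3 * p * q ^ 2 + q ^ 4 = 0) :
    p = 0 ∧ q = 0 := by
  have hq : q = 0 := by
    by_contra hq
    -- Completing the square, 4(p² + 3pq² + q⁴) = (2p + 3q²)² − 5q⁴, so q ≠ 0 would make √5
    -- rational.
    have h5 : ((2 * p + 3 * q ^ 2) / q ^ 2) ^ 2 = 5 := by
      field_simp
      linear_combination 4 * h
    have hirr := Nat.Prime.irrational_sqrt (show Nat.Prime 5 by norm_num)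
    apply hirr
    refine ⟨|(2 * p + 3 * q ^ 2) / q ^ 2|, ?_⟩
    rw [Rat.cast_abs, ← Real.sqrt_sq_eq_abs]
    congr 1
    exact_mod_cast h5
  subst hq
  simpa using h

end NilpotentOrbits

theorem mainTheorem3 :
    -- the partition is of type (P9), with `z = 0`, `m = 2`, `t = 1`, and of no other type
    (NilpotentOrbits.IsTypeP9 9 NilpotentOrbits.partition5553 ∧
      NilpotentOrbits.IsTypeP9With 9 NilpotentOrbits.partition5553 0 2 1 ∧
      ¬ NilpotentOrbits.IsTypeP1 9 NilpotentOrbits.partition5553 ∧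
      ¬ NilpotentOrbits.IsTypeP2 9 NilpotentOrbits.partition5553 ∧
      ¬ NilpotentOrbits.IsTypeP3 9 NilpotentOrbits.partition5553 ∧
      ¬ NilpotentOrbits.IsTypeP4 9 NilpotentOrbits.partition5553 ∧
      ¬ NilpotentOrbits.IsTypeP5 9 NilpotentOrbits.partition5553 ∧
      ¬ NilpotentOrbits.IsTypeP6 9 NilpotentOrbits.partition5553 ∧
      ¬ NilpotentOrbits.IsTypeP7 9 NilpotentOrbits.partition5553 ∧
      ¬ NilpotentOrbits.IsTypeP8 9 NilpotentOrbits.partition5553) ∧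
    -- over any field, an intersection forces a nonzero solution of the equation
    (∀ (F : Type*) [Field F] (B : Matrix (Fin (2 * 9)) (Fin (2 * 9)) F),
      B ∈ NilpotentOrbits.nilpotentOrbit F NilpotentOrbits.partition99 →
      (NilpotentOrbits.nilpotentCentralizer B ∩
        NilpotentOrbits.nilpotentOrbit F NilpotentOrbits.partition5553).Nonempty →
      ∃ p₀ q₀ : F, p₀ ≠ 0 ∧ q₀ ≠ 0 ∧ p₀ ^ 2 + 3 * p₀ * q₀ ^ 2 + q₀ ^ 4 = 0) ∧
    -- the equation has no nonzero rational solution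
    (∀ p₀ q₀ : ℚ, p₀ ^ 2 + 3 * p₀ * q₀ ^ 2 + q₀ ^ 4 = 0 → p₀ = 0 ∧ q₀ = 0) ∧
    -- over the rationals there is no intersection
    (∀ B : Matrix (Fin (2 * 9)) (Fin (2 * 9)) ℚ,
      B ∈ NilpotentOrbits.nilpotentOrbit ℚ NilpotentOrbits.partition99 →
      NilpotentOrbits.nilpotentCentralizer B ∩
        NilpotentOrbits.nilpotentOrbit ℚ NilpotentOrbits.partition5553 = ∅) := by
  refine ⟨⟨⟨0, 2, 1, NilpotentOrbits.isTypeP9With_partition5553⟩,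
    NilpotentOrbits.isTypeP9With_partition5553, NilpotentOrbits.not_isTypeP1_partition5553,
    NilpotentOrbits.not_isTypeP2_partition5553, NilpotentOrbits.not_isTypeP3_partition5553,
    NilpotentOrbits.not_isTypeP4_partition5553, NilpotentOrbits.not_isTypeP5_partition5553,
    NilpotentOrbits.not_isTypeP6_partition5553, NilpotentOrbits.not_isTypeP7_partition5553,
    NilpotentOrbits.not_isTypeP8_partition5553⟩, ?_,
    fun p q h => NilpotentOrbits.eq_zero_of_rat_solution h, ?_⟩
  · rintro F _ B hB ⟨A, ⟨hAB, -⟩, hA⟩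
    exact NilpotentOrbits.exists_solution_of_mem_orbits hB hAB hA
  · intro B hB
    refine Set.eq_empty_iff_forall_notMem.2 ?_
    rintro A ⟨⟨hAB, -⟩, hA⟩
    obtain ⟨p, q, hp, -, h⟩ := NilpotentOrbits.exists_solution_of_mem_orbits hB hAB hA
    exact hp (NilpotentOrbits.eq_zero_of_rat_solution h).1
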